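/- **Definitions.** For a real parameter $m$ let $G_k^m$ be the Gegenbauer polynomials given by $G_0^m(t)=1$, $G_1^m(t)=t$ and $$G_k^m(t)=\frac{(2k+m-4)\,t\,G_{k-1}^m(t)-(k-1)\,G_{k-2}^m(t)}{k+m-3}\qquad(k\ge 2).$$ Fix integers $n\ge 1$ and $p_{LP},p_{SDP}\ge 0$, where $n\ge 3$ or $p_{SDP}\le 1$. For $0\le k\le p_{SDP}$ let $Y_k^n(u,v,t)$ be the $(p_{SDP}-k+1)\times(p_{SDP}-k+1)$ matrix with entries, for $0\le i,j\le p_{SDP}-k$, $$(Y_k^n(u,v,t))_{ij}=u^iv^j\big((1-u^2)(1-v^2)\big)^{k/2}\,G_k^{n-1}\!\left(\frac{t-uv}{\sqrt{(1-u^2)(1-v^2)}}\right),$$ which are polynomials in $u,v,t$ and are read as such also where $u^2=1$ or $v^2=1$. Let $$S_k^n(u,v,t)=\frac16\sum_{\sigma}Y_k^n(\sigma(u,v,t)),$$ where $\sigma$ runs over the six permutations of the three arguments; in particular $S_k^n(1,1,1)=0$ for $k\ge1$. Write $A\succeq0$ if the real symmetric matrix $A$ is positive semidefinite. A *spherical three-distance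 set with inner product values* $d_1,d_2,d_3$ is a finite set $X$ of unit vectors in $\mathbb R^n$ such that $\{\langle x,y\rangle : x,y\in X,\ x\ne y\}=\{d_1,d_2,d_3\}$, where $d_1,d_2,d_3$ are pairwise different. **Theorem.** Let $X\subset\mathbb R^n$ be a spherical three-distance set with inner product values $d_1,d_2,d_3$. Then $|X|$ is at most the optimal value (the supremum, which is $+\infty$ if the program is unbounded) of the following semidefinite program in $x_1,\dots,x_{13}\in\mathbb R$: $$\text{maximize}\quad 1+\tfrac13(x_1+x_2+x_3)$$ subject to $$\begin{pmatrix}1&0\\0&0\end{pmatrix}+\frac13(x_1+x_2+x_3)\begin{pmatrix}0&1\\1&1\end{pmatrix}+\Big(\sum_{i=4}^{13}x_i\Big)\begin{pmatrix}0&0\\0&1\end{pmatrix}\succeq0,$$ $$3+x_1G_k^n(d_1)+x_2G_k^n(d_2)+x_3G_k^n(d_3)\ge0,\qquad k=1,\dots,p_{LP},$$ $$\begin{aligned} &S_k^n(1,1,1)+x_1S_k^n(d_1,d_1,1)+x_2S_k^n(d_2,d_2,1)+x_3S_k^n(d_3,d_3,1)\\ &+x_4S_k^n(d_1,d_1,d_1)+x_5S_k^n(d_2,d_2,d_2)+x_6S_k^n(d_3,d_3,d_3)\\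 &+x_7S_k^n(d_1,d_1,d_2)+x_8S_k^n(d_1,d_1,d_3)+x_9S_k^n(d_2,d_2,d_1)\\ &+x_{10}S_k^n(d_2,d_2,d_3)+x_{11}S_k^n(d_3,d_3,d_1)+x_{12}S_k^n(d_3,d_3,d_2)\\ &+x_{13}S_k^n(d_1,d_2,d_3)\succeq0,\qquad k=0,1,\dots,p_{SDP}, \end{aligned}$$ $$x_j\ge0,\qquad j=1,\dots,13.$$ Moreover, the variables count triples of points: if $x_j$ is $\frac1{|X|}$ times the number of triples $(x,y,z)\in X^3$ for which $\langle x,y\rangle,\langle x,z\rangle,\langle y,z\rangle$ are, up to order, the arguments of the matrix $S_k^n$ that $x_j$ multiplies above, then $(x_1,\dots,x_{13})$ is feasible and its objective value is $|X|$. -/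

import Mathlib

namespace ThreeDistanceSDP

/-- The Gegenbauer polynomial `G_k^n(t)`, normalized by `G_k^n(1) = 1`, through its three-term
recurrence
`G_k^n(t) = ((2k + n - 4) t G_{k-1}^n(t) - (k - 1) G_{k-2}^n(t)) / (k + n - 3)` for `k ≥ 2`.
The dimension parameter is taken in `ℝ`, so that no subtraction is truncated. -/
noncomputable def gegenbauer (n : ℝ) : ℕ → ℝ → ℝ
  | 0, _ => 1
  | 1, t => t
  | k + 2, t =>
      ((2 * ((k : ℝ) + 2) + n - 4) * t * gegenbauer n (k + 1) t
        - (((k : ℝ) + 2) - 1) * gegenbauer n k t) / (((k : ℝ) + 2) + n - 3)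

/-- The polynomial in `c` and `w` which for `w > 0` equals `w^{k/2} G_k^n(c / √w)`
(see `homGegenbauer_eq`). At `w = 0` it is the continuous extension of that expression. -/
noncomputable def homGegenbauer (n : ℝ) : ℕ → ℝ → ℝ → ℝ
  | 0, _, _ => 1
  | 1, c, _ => c
  | k + 2, c, w =>
      ((2 * ((k : ℝ) + 2) + n - 4) * c * homGegenbauer n (k + 1) c w
        - (((k : ℝ) + 2) - 1) * w * homGegenbauer n k c w) / (((k : ℝ) + 2) + n - 3)

theorem homGegenbauer_eq_sqrt (n c w : ℝ) (hw : 0 < w) (k : ℕ) :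
    homGegenbauer n k c w = (√w) ^ k * gegenbauer n k (c / √w)
      ∧ homGegenbauer n (k + 1) c w = (√w) ^ (k + 1) * gegenbauer n (k + 1) (c / √w) := by
  have hs : √w ≠ 0 := (Real.sqrt_pos.mpr hw).ne'
  have hsq : √w * √w = w := Real.mul_self_sqrt hw.le
  induction k with
  | zero =>
    refine ⟨by simp [homGegenbauer, gegenbauer], ?_⟩
    simp only [homGegenbauer, gegenbauer, zero_add, pow_one]
    field_simp
  | succ k ih =>
    refine ⟨ih.2, ?_⟩
    have hc : c = √w * (c / √w) := by field_simp
    have e : ∀ A B y : ℝ, (A * (√w * y) * ((√w) ^ (k + 1) * gegenbauer n (k + 1) y)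
        - B * (√w * √w) * ((√w) ^ k * gegenbauer n k y))
        = (√w) ^ (k + 2) * (A * y * gegenbauer n (k + 1) y - B * gegenbauer n k y) := by
      intro A B y; ring
    rw [homGegenbauer, gegenbauer, ih.1, ih.2, mul_div_assoc', ← e, hsq, ← hc]

theorem homGegenbauer_eq (n c w : ℝ) (hw : 0 < w) (k : ℕ) :
    homGegenbauer n k c w = w ^ ((k : ℝ) / 2) * gegenbauer n k (c / √w) := by
  rw [(homGegenbauer_eq_sqrt n c w hw k).1, Real.sqrt_eq_rpow, ← Real.rpow_mul_natCast hw.le]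
  congr 2
  ring

/-- The matrix `Y_k^n(u,v,t)` of size `(p - k + 1) × (p - k + 1)`, with entries
`u^i v^j ((1-u²)(1-v²))^{k/2} G_k^{n-1}((t - uv) / √((1-u²)(1-v²)))`, `0 ≤ i, j ≤ p - k`,
read as polynomials in `u, v, t`. The argument `w` is the triple `(u,v,t)`. -/
noncomputable def matY (n p k : ℕ) (w : Fin 3 → ℝ) :
    Matrix (Fin (p - k + 1)) (Fin (p - k + 1)) ℝ :=
  Matrix.of fun i j =>
    w 0 ^ (i : ℕ) * w 1 ^ (j : ℕ)
      * homGegenbauer ((n : ℝ) - 1) k (w 2 - w 0 * w 1) ((1 - w 0 ^ 2) * (1 - w 1 ^ 2))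

theorem matY_apply (n p k : ℕ) (u v t : ℝ) (hu : u ^ 2 < 1) (hv : v ^ 2 < 1)
    (i j : Fin (p - k + 1)) :
    matY n p k ![u, v, t] i j
      = u ^ (i : ℕ) * v ^ (j : ℕ) * ((1 - u ^ 2) * (1 - v ^ 2)) ^ ((k : ℝ) / 2)
        * gegenbauer ((n : ℝ) - 1) k ((t - u * v) / √((1 - u ^ 2) * (1 - v ^ 2))) := by
  have h : 0 < (1 - u ^ 2) * (1 - v ^ 2) := mul_pos (by linarith) (by linarith)
  simp [matY, homGegenbauer_eq _ _ _ h, mul_assoc]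

/-- `S_k^n(u,v,t)`, the average of `Y_k^n` over all permutations of `(u,v,t)`. -/
noncomputable def matS (n p k : ℕ) (w : Fin 3 → ℝ) :
    Matrix (Fin (p - k + 1)) (Fin (p - k + 1)) ℝ :=
  (1 / 6 : ℝ) • ∑ σ : Equiv.Perm (Fin 3), matY n p k (w ∘ σ)

theorem homGegenbauer_zero (n : ℝ) (k : ℕ) : homGegenbauer n (k + 1) 0 0 = 0 := by
  cases k <;> simp [homGegenbauer]

/-- The convention `S_k^n(1,1,1) = 0` for `k ≥ 1`. -/
theorem matS_one (n p k : ℕ) (hk : 1 ≤ k) : matS n p k ![1, 1, 1] = 0 := by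
  obtain ⟨k, rfl⟩ := Nat.exists_eq_add_of_le' hk
  have h1 : (![1, 1, 1] : Fin 3 → ℝ) = fun _ => 1 := by
    funext i; fin_cases i <;> rfl
  have h : ∀ σ : Equiv.Perm (Fin 3), matY n p (k + 1) (![1, 1, 1] ∘ σ) = 0 := by
    intro σ
    ext i j
    simp [matY, h1, homGegenbauer_zero]
  simp [matS, h]

/-- The triple of inner products to which the variable `x_{j+1}` belongs, `j = 0, …, 12`. -/
def pattern (d₁ d₂ d₃ : ℝ) : Fin 13 → Fin 3 → ℝ :=
  ![![d₁, d₁, 1], ![d₂, d₂, 1], ![d₃, d₃, 1],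
    ![d₁, d₁, d₁], ![d₂, d₂, d₂], ![d₃, d₃, d₃],
    ![d₁, d₁, d₂], ![d₁, d₁, d₃], ![d₂, d₂, d₁],
    ![d₂, d₂, d₃], ![d₃, d₃, d₁], ![d₃, d₃, d₂],
    ![d₁, d₂, d₃]]

/-- Objective function `1 + (x₁ + x₂ + x₃)/3`; the variable `x_{j+1}` is `x j`. -/
noncomputable def objective (x : Fin 13 → ℝ) : ℝ := 1 + (1 / 3) * (x 0 + x 1 + x 2)

/-- The constraints of the semidefinite program. -/
structure IsFeasible (n pLP pSDP : ℕ) (d₁ d₂ d₃ : ℝ) (x : Fin 13 → ℝ) : Prop where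
  psd_two :
    (!![1, 0; 0, 0] + ((1 / 3 : ℝ) * (x 0 + x 1 + x 2)) • !![0, 1; 1, 1]
      + (∑ j ∈ Finset.Ici (3 : Fin 13), x j) • !![0, 0; 0, 1]
      : Matrix (Fin 2) (Fin 2) ℝ).PosSemidef
  delsarte : ∀ k : ℕ, 1 ≤ k → k ≤ pLP →
    0 ≤ 3 + x 0 * gegenbauer n k d₁ + x 1 * gegenbauer n k d₂ + x 2 * gegenbauer n k d₃
  psd_S : ∀ k : ℕ, k ≤ pSDP →
    (matS n pSDP k ![1, 1, 1]
      + ∑ j : Fin 13, x j • matS n pSDP k (pattern d₁ d₂ d₃ j)).PosSemidef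
  nonneg : ∀ j, 0 ≤ x j

/-- The optimal value of the program: the supremum of the objective over the feasible points,
equal to `⊤` if the program is unbounded. -/
noncomputable def sdpOptimum (n pLP pSDP : ℕ) (d₁ d₂ d₃ : ℝ) : EReal :=
  sSup {v : EReal | ∃ x : Fin 13 → ℝ, IsFeasible n pLP pSDP d₁ d₂ d₃ x ∧ v = (objective x : ℝ)}

/-- A finite set of unit vectors whose inner products between distinct points are exactly
the three different values `d₁, d₂, d₃`. -/
structure IsThreeDistanceSet {n : ℕ} (X : Finset (EuclideanSpace ℝ (Fin n)))
    (d₁ d₂ d₃ : ℝ) : Prop where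
  norm_eq_one : ∀ x ∈ X, ‖x‖ = 1
  ne₁₂ : d₁ ≠ d₂
  ne₁₃ : d₁ ≠ d₃
  ne₂₃ : d₂ ≠ d₃
  inner_eq : {s : ℝ | ∃ x ∈ X, ∃ y ∈ X, x ≠ y ∧ inner ℝ x y = s} = {d₁, d₂, d₃}

/-- The number of triples `(x,y,z) ∈ X³` whose inner products `x·y, x·z, y·z` are, up to order,
the triple `pattern d₁ d₂ d₃ j`, divided by `|X|`. -/
noncomputable def tripleCount {n : ℕ} (X : Finset (EuclideanSpace ℝ (Fin n)))
    (d₁ d₂ d₃ : ℝ) (j : Fin 13) : ℝ :=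
  (Set.ncard {q : EuclideanSpace ℝ (Fin n) × EuclideanSpace ℝ (Fin n) × EuclideanSpace ℝ (Fin n) |
      q.1 ∈ X ∧ q.2.1 ∈ X ∧ q.2.2 ∈ X ∧
      ∃ σ : Equiv.Perm (Fin 3),
        ![inner ℝ q.1 q.2.1, inner ℝ q.1 q.2.2, inner ℝ q.2.1 q.2.2] ∘ σ
          = pattern d₁ d₂ d₃ j} : ℝ) / (X.card : ℝ)

end ThreeDistanceSDP

namespace ThreeDistanceSDP

/-! The counted variables are themselves a feasible point with objective `|X|`, so the supremum is
at least `|X|`. Averaging a function over the permutations of its arguments does not change its sum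
over all ordered triples of `X`. Grouping triples by their inner products up to order therefore
turns each constraint into `1/|X|` times a sum over points (`IsThreeDistanceSet.sum_tripleInner`).

For the matrix constraints, fix the vertex `z` and project the other points to the hyperplane
orthogonal to `z`. The quadratic form of the summed `Y_k` is then a weighted double sum of the
homogenized Gegenbauer kernel in dimension `n - 1` (`sum_matY_posSemidef`). The linear constraints
are the same kernel inequality on `X` in dimension `n`; the 2 × 2 matrix has rank one.

The kernel is positive definite (`sum_homGegenbauer_nonneg`) by an algebraic argument. Zonal
polynomials are harmonic, and each is a positive multiple of a power of a linear form modulo the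
squared norm. For the Fischer form, harmonic polynomials are orthogonal to multiples of the squared
norm, and powers of linear forms reproduce values. So the kernel sum is a positive multiple of `⟨P,
P⟩ ≥ 0` for a combination `P` of zonal polynomials. -/

open MvPolynomial

/-! ### The Fischer form on polynomials. -/

section Fischer

variable {ι : Type*} [Fintype ι]

/-- The Fischer form `⟨p, q⟩ = ∑ α, α! p_α q_α` on polynomials. -/
noncomputable def fischer (ι : Type*) [Fintype ι] :
    MvPolynomial ι ℝ →ₗ[ℝ] MvPolynomial ι ℝ →ₗ[ℝ] ℝ :=
  (basisMonomials ι ℝ).constr ℝ fun α => (∏ i, ((α i).factorial : ℝ)) • lcoeff ℝ α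

theorem fischer_monomial (α : ι →₀ ℕ) (a : ℝ) (q : MvPolynomial ι ℝ) :
    fischer ι (monomial α a) q = a * ((∏ i, ((α i).factorial : ℝ)) * coeff α q) := by
  have h : monomial α a = a • basisMonomials ι ℝ α := by simp [smul_monomial]
  rw [h, map_smul, fischer, Module.Basis.constr_basis]
  simp [lcoeff]

theorem fischer_self_nonneg (p : MvPolynomial ι ℝ) : 0 ≤ fischer ι p p := by
  conv_rhs => enter [1]; rw [p.as_sum]
  rw [map_sum, LinearMap.sum_apply]
  refine Finset.sum_nonneg fun α _ => ?_
  rw [fischer_monomial]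
  have h : 0 ≤ ∏ i, ((α i).factorial : ℝ) := by positivity
  nlinarith [mul_nonneg h (mul_self_nonneg (coeff α p))]

/-- The factorial weights are chosen for this adjointness: raising `α i` by one multiplies the
weight by `α i + 1`, which is also the factor produced by differentiation. -/
theorem fischer_X_mul (i : ι) (p q : MvPolynomial ι ℝ) :
    fischer ι (X i * p) q = fischer ι p (pderiv i q) := by
  classical
  induction p using MvPolynomial.induction_on' with
  | monomial α a =>
    have h : (X i : MvPolynomial ι ℝ) * monomial α a = monomial (α + Finsupp.single i 1) a := by
      rw [X, monomial_mul, one_mul, add_comm]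
    rw [h, fischer_monomial, fischer_monomial, coeff_pderiv]
    have h2 : ∏ j, (((α + Finsupp.single i 1 : ι →₀ ℕ) j).factorial : ℝ)
        = (α i + 1) * ∏ j, ((α j).factorial : ℝ) := by
      rw [← Finset.mul_prod_erase _ _ (Finset.mem_univ i),
        ← Finset.mul_prod_erase Finset.univ (fun j => ((α j).factorial : ℝ)) (Finset.mem_univ i)]
      have h3 : ∏ j ∈ Finset.univ.erase i, (((α + Finsupp.single i 1 : ι →₀ ℕ) j).factorial : ℝ)
          = ∏ j ∈ Finset.univ.erase i, ((α j).factorial : ℝ) := by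
        refine Finset.prod_congr rfl fun j hj => ?_
        simp [(Finset.ne_of_mem_erase hj).symm]
      rw [h3]
      simp [Nat.factorial_succ, mul_assoc]
    rw [h2]
    ring
  | add p q hp hq => simp [mul_add, hp, hq]

/-- The squared norm `∑ X_i²` as a polynomial. -/
noncomputable def normSqPoly (ι : Type*) [Fintype ι] : MvPolynomial ι ℝ := ∑ i, X i * X i

/-- The linear form `∑ x_i X_i`. -/
noncomputable def linearForm (x : ι → ℝ) : MvPolynomial ι ℝ := ∑ i, C (x i) * X i

/-- The derivative `∑ x_i ∂_i` in the direction `x`. -/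
noncomputable def dirDeriv (x : ι → ℝ) : Derivation ℝ (MvPolynomial ι ℝ) (MvPolynomial ι ℝ) :=
  ∑ i, x i • pderiv i

theorem dirDeriv_apply (x : ι → ℝ) (p : MvPolynomial ι ℝ) :
    dirDeriv x p = ∑ i, C (x i) * pderiv i p := by
  simp only [dirDeriv, ← Derivation.coeFnAddMonoidHom_apply, map_sum, Finset.sum_apply]
  simp [smul_eq_C_mul]

/-- The Laplacian on polynomials. -/
noncomputable def laplacePoly (p : MvPolynomial ι ℝ) : MvPolynomial ι ℝ :=
  ∑ i, pderiv i (pderiv i p)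

theorem fischer_linearForm_mul (x : ι → ℝ) (p q : MvPolynomial ι ℝ) :
    fischer ι (linearForm x * p) q = fischer ι p (dirDeriv x q) := by
  rw [linearForm, Finset.sum_mul, map_sum, LinearMap.sum_apply, dirDeriv_apply, map_sum]
  refine Finset.sum_congr rfl fun i _ => ?_
  rw [mul_assoc, ← smul_eq_C_mul, ← smul_eq_C_mul, map_smul, map_smul, LinearMap.smul_apply,
    fischer_X_mul]

/-- Makes harmonic polynomials orthogonal to all multiples of the squared norm. -/
theorem fischer_normSqPoly_mul (p q : MvPolynomial ι ℝ) :
    fischer ι (normSqPoly ι * p) q = fischer ι p (laplacePoly q) := by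
  rw [normSqPoly, Finset.sum_mul, map_sum, LinearMap.sum_apply, laplacePoly, map_sum]
  exact Finset.sum_congr rfl fun i _ => by rw [mul_assoc, fischer_X_mul, fischer_X_mul]

theorem dirDeriv_isHomogeneous (x : ι → ℝ) {p : MvPolynomial ι ℝ} {k : ℕ}
    (hp : p.IsHomogeneous k) : (dirDeriv x p).IsHomogeneous (k - 1) := by
  rw [dirDeriv_apply]
  refine IsHomogeneous.sum _ _ _ fun i _ => ?_
  simpa using (isHomogeneous_C ι (x i)).mul hp.pderiv

theorem eval_dirDeriv_self (x : ι → ℝ) {p : MvPolynomial ι ℝ} {k : ℕ}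
    (hp : p.IsHomogeneous k) : eval x (dirDeriv x p) = k * eval x p := by
  have h := congrArg (eval x) hp.sum_X_mul_pderiv
  simpa [dirDeriv_apply] using h

/-- Powers of linear forms reproduce the values of homogeneous polynomials. -/
theorem fischer_linearForm_pow (x : ι → ℝ) {k : ℕ} {p : MvPolynomial ι ℝ}
    (hp : p.IsHomogeneous k) : fischer ι (linearForm x ^ k) p = k.factorial * eval x p := by
  induction k generalizing p with
  | zero =>
    have h1 : (1 : MvPolynomial ι ℝ) = monomial 0 1 := rfl
    rw [pow_zero, h1, fischer_monomial]
    obtain ⟨a, rfl⟩ : ∃ a, p = C a :=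
      ⟨_, totalDegree_eq_zero_iff_eq_C.mp (Nat.le_zero.mp hp.totalDegree_le)⟩
    simp
  | succ k ih =>
    -- One linear factor moves across as a derivative along `x`; at the point `x` itself, Euler's
    -- identity evaluates it with factor `k + 1`.
    rw [pow_succ', fischer_linearForm_mul, ih (by simpa using dirDeriv_isHomogeneous x hp),
      eval_dirDeriv_self x hp, Nat.factorial_succ]
    push_cast
    ring

end Fischer

/-! ### Zonal harmonics and positive definiteness of the Gegenbauer kernel. -/

section Zonal

variable {ι : Type*} [Fintype ι]

theorem pderiv_linearForm (x : ι → ℝ) (i : ι) : pderiv i (linearForm x) = C (x i) := by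
  classical
  simp [linearForm, pderiv_X, Pi.single_apply]

theorem pderiv_normSqPoly (i : ι) : pderiv i (normSqPoly ι) = 2 * X i := by
  classical
  simp [normSqPoly, pderiv_X, Pi.single_apply, two_mul, Finset.sum_add_distrib]

theorem dirDeriv_linearForm (x : ι → ℝ) : dirDeriv x (linearForm x) = C (∑ i, x i * x i) := by
  simp [dirDeriv_apply, pderiv_linearForm]

theorem dirDeriv_normSqPoly (x : ι → ℝ) : dirDeriv x (normSqPoly ι) = 2 * linearForm x := by
  rw [dirDeriv_apply, linearForm, Finset.mul_sum]
  exact Finset.sum_congr rfl fun i _ => by rw [pderiv_normSqPoly]; ring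

theorem laplacePoly_linearForm_mul (x : ι → ℝ) (p : MvPolynomial ι ℝ) :
    laplacePoly (linearForm x * p) = 2 * dirDeriv x p + linearForm x * laplacePoly p := by
  rw [laplacePoly, laplacePoly, dirDeriv_apply, Finset.mul_sum, Finset.mul_sum,
    ← Finset.sum_add_distrib]
  refine Finset.sum_congr rfl fun i _ => ?_
  simp only [pderiv_mul, pderiv_linearForm, map_add, pderiv_C]
  ring

/-- In the constant, `2 |ι|` is the Laplacian of the squared norm and `4 k` comes from the cross
term by Euler's identity. -/
theorem laplacePoly_normSqPoly_mul {p : MvPolynomial ι ℝ} {k : ℕ} (hp : p.IsHomogeneous k) :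
    laplacePoly (normSqPoly ι * p)
      = C (2 * (Fintype.card ι : ℝ) + 4 * k) * p + normSqPoly ι * laplacePoly p := by
  have h : laplacePoly (normSqPoly ι * p)
      = ∑ i : ι, 2 * p + 4 * ∑ i, X i * pderiv i p + normSqPoly ι * laplacePoly p := by
    rw [laplacePoly, laplacePoly, Finset.mul_sum, Finset.mul_sum, ← Finset.sum_add_distrib,
      ← Finset.sum_add_distrib]
    refine Finset.sum_congr rfl fun i _ => ?_
    have h2 : pderiv i (2 * X i : MvPolynomial ι ℝ) = 2 := by
      have : (2 : MvPolynomial ι ℝ) = C 2 := rfl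
      rw [this, pderiv_C_mul]; simp
    simp only [pderiv_mul, pderiv_normSqPoly, map_add, h2]
    ring
  rw [h, hp.sum_X_mul_pderiv]
  simp only [Finset.sum_const, Finset.card_univ, nsmul_eq_mul, C_add, C_mul, map_natCast,
    map_ofNat]
  ring

theorem laplacePoly_sub (p q : MvPolynomial ι ℝ) :
    laplacePoly (p - q) = laplacePoly p - laplacePoly q := by
  simp [laplacePoly]

theorem laplacePoly_C_mul (a : ℝ) (p : MvPolynomial ι ℝ) :
    laplacePoly (C a * p) = C a * laplacePoly p := by
  simp [laplacePoly, Finset.mul_sum]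

/-- The zonal polynomial with pole `x`: as a function of `y` it is
`homGegenbauer |ι| k ⟨x, y⟩ (|x|² |y|²)`. -/
noncomputable def zonal (x : ι → ℝ) : ℕ → MvPolynomial ι ℝ
  | 0 => 1
  | 1 => linearForm x
  | k + 2 =>
      C ((k + Fintype.card ι - 1 : ℝ)⁻¹) *
        (C (2 * k + Fintype.card ι : ℝ) * (linearForm x * zonal x (k + 1))
          - C ((k + 1) * ∑ i, x i * x i) * (normSqPoly ι * zonal x k))

theorem eval_zonal (x y : ι → ℝ) (k : ℕ) :
    eval y (zonal x k) = homGegenbauer (Fintype.card ι) k (∑ i, x i * y i)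
        ((∑ i, x i * x i) * ∑ i, y i * y i)
      ∧ eval y (zonal x (k + 1)) = homGegenbauer (Fintype.card ι) (k + 1) (∑ i, x i * y i)
        ((∑ i, x i * x i) * ∑ i, y i * y i) := by
  induction k with
  | zero => simp [zonal, homGegenbauer, linearForm]
  | succ k ih =>
    refine ⟨ih.2, ?_⟩
    have e : (k : ℝ) + 2 + Fintype.card ι - 3 = k + Fintype.card ι - 1 := by ring
    rw [zonal, homGegenbauer, ← ih.1, ← ih.2, e, div_eq_inv_mul]
    simp only [map_mul, map_sub, eval_C, linearForm, normSqPoly, map_sum, eval_X]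
    ring

theorem zonal_isHomogeneous (x : ι → ℝ) (k : ℕ) :
    (zonal x k).IsHomogeneous k ∧ (zonal x (k + 1)).IsHomogeneous (k + 1) := by
  have hl : (linearForm x).IsHomogeneous 1 := IsHomogeneous.sum _ _ _ fun i _ => by
    simpa using (isHomogeneous_C ι (x i)).mul (isHomogeneous_X ℝ i)
  have hr : (normSqPoly ι).IsHomogeneous 2 := IsHomogeneous.sum _ _ _ fun i _ =>
    (isHomogeneous_X ℝ i).mul (isHomogeneous_X ℝ i)
  have hC : ∀ (a : ℝ) {p : MvPolynomial ι ℝ} {d : ℕ}, p.IsHomogeneous d →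
      (C a * p).IsHomogeneous d := fun a p d hp => by
    simpa using (isHomogeneous_C ι a).mul hp
  induction k with
  | zero => exact ⟨isHomogeneous_one ι ℝ, hl⟩
  | succ k ih =>
    refine ⟨ih.2, hC _ (IsHomogeneous.sub (hC _ ?_) (hC _ ?_))⟩
    · have := hl.mul ih.2
      rwa [show 1 + (k + 1) = k + 1 + 1 by ring] at this
    · have := hr.mul ih.1
      rwa [show 2 + k = k + 1 + 1 by ring] at this

/-- In dimension one the denominator vanishes at `k = 0`, which is why the dimension is assumed to
be at least two from here on. -/
theorem C_mul_zonal (x : ι → ℝ) (hm : 2 ≤ Fintype.card ι) (k : ℕ) :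
    C (k + Fintype.card ι - 1 : ℝ) * zonal x (k + 2)
      = C (2 * k + Fintype.card ι : ℝ) * (linearForm x * zonal x (k + 1))
          - C ((k + 1) * ∑ i, x i * x i) * (normSqPoly ι * zonal x k) := by
  have h : (k + Fintype.card ι - 1 : ℝ) ≠ 0 := by
    have : (2 : ℝ) ≤ Fintype.card ι := by exact_mod_cast hm
    have := k.cast_nonneg (α := ℝ)
    linarith
  rw [zonal, ← mul_assoc, ← C_mul, mul_inv_cancel₀ h, C_1, one_mul]

theorem dirDeriv_C_mul (x : ι → ℝ) (a : ℝ) (p : MvPolynomial ι ℝ) :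
    dirDeriv x (C a * p) = C a * dirDeriv x p := by
  rw [← smul_eq_C_mul, ← smul_eq_C_mul, Derivation.map_smul]

theorem C_mul_cancel {σ : Type*} {a : ℝ} (ha : a ≠ 0) {p q : MvPolynomial σ ℝ} (h : C a * p = C a * q) :
    p = q :=
  mul_left_cancel₀ (by simpa using ha) h

/-- Differentiating along the pole lowers the degree within the zonal family. This supplies the
cross term in the Laplacian of the recurrence; two consecutive degrees are carried because the
recurrence has depth two. -/
theorem dirDeriv_zonal (x : ι → ℝ) (hm : 2 ≤ Fintype.card ι) (k : ℕ) :
    dirDeriv x (zonal x (k + 1)) = C ((k + 1) * ∑ i, x i * x i) * zonal x k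
      ∧ dirDeriv x (zonal x (k + 2)) = C ((k + 2) * ∑ i, x i * x i) * zonal x (k + 1) := by
  have hm' : (2 : ℝ) ≤ Fintype.card ι := by exact_mod_cast hm
  have hne : ∀ k : ℕ, (k + Fintype.card ι - 1 : ℝ) ≠ 0 := fun k => by
    have := k.cast_nonneg (α := ℝ)
    linarith
  have hcomp : ∀ k : ℕ, C (k + Fintype.card ι - 1 : ℝ) * dirDeriv x (zonal x (k + 2))
      = C (2 * k + Fintype.card ι : ℝ) * (linearForm x * dirDeriv x (zonal x (k + 1))
            + zonal x (k + 1) * C (∑ i, x i * x i))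
          - C ((k + 1) * ∑ i, x i * x i) * (normSqPoly ι * dirDeriv x (zonal x k)
            + zonal x k * (2 * linearForm x)) := fun k => by
    rw [← dirDeriv_C_mul, C_mul_zonal x hm, map_sub, dirDeriv_C_mul, dirDeriv_C_mul,
      Derivation.leibniz, Derivation.leibniz, dirDeriv_linearForm, dirDeriv_normSqPoly]
    simp only [smul_eq_mul]
  induction k with
  | zero =>
    have h1 : dirDeriv x (zonal x 1) = C (∑ i, x i * x i) * zonal x 0 := by
      simp [zonal, dirDeriv_linearForm]
    refine ⟨by simpa using h1, C_mul_cancel (hne 0) ?_⟩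
    rw [hcomp 0, h1]
    have h0 : dirDeriv x (zonal x 0) = 0 := by simp [zonal]
    rw [h0]
    simp only [zonal]
    simp only [C_mul, C_add, C_sub, map_ofNat, map_natCast, C_1, Nat.cast_zero, C_0]
    ring
  | succ k ih =>
    refine ⟨by simpa [add_assoc, one_add_one_eq_two] using ih.2, C_mul_cancel (hne (k + 1)) ?_⟩
    have hrec := C_mul_zonal x hm k
    rw [hcomp (k + 1), ih.1, ih.2]
    simp only [C_mul, C_add, C_sub, map_ofNat, map_natCast, C_1, Nat.cast_add, Nat.cast_one]
      at hrec ⊢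
    -- After both induction hypotheses are inserted, what remains is a multiple of the recurrence
    -- one degree lower.
    linear_combination (-(k + 2) * C (∑ i, x i * x i)) * hrec

/-- The two surviving terms, `2 (2k + m) (k + 1) |x|²` and `(k + 1) |x|² (2m + 4k)` times the zonal
polynomial of degree `k`, cancel. -/
theorem laplacePoly_zonal (x : ι → ℝ) (hm : 2 ≤ Fintype.card ι) (k : ℕ) :
    laplacePoly (zonal x k) = 0 ∧ laplacePoly (zonal x (k + 1)) = 0 := by
  induction k with
  | zero => simp [zonal, laplacePoly, pderiv_linearForm]
  | succ k ih =>
    refine ⟨ih.2, ?_⟩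
    rw [zonal, laplacePoly_C_mul, laplacePoly_sub, laplacePoly_C_mul, laplacePoly_C_mul,
      laplacePoly_linearForm_mul, laplacePoly_normSqPoly_mul (zonal_isHomogeneous x k).1,
      ih.1, ih.2, (dirDeriv_zonal x hm k).1]
    simp only [C_mul, C_add, map_ofNat, map_natCast, C_1]
    ring

/-- The coefficient of `⟨x, y⟩ ^ k` in the zonal polynomial of degree `k` in dimension `m`. -/
noncomputable def zonalLead (m : ℝ) : ℕ → ℝ
  | 0 => 1
  | 1 => 1
  | k + 2 => (k + m - 1)⁻¹ * ((2 * k + m) * zonalLead m (k + 1))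

theorem zonalLead_pos {m : ℝ} (hm : 2 ≤ m) (k : ℕ) :
    0 < zonalLead m k ∧ 0 < zonalLead m (k + 1) := by
  induction k with
  | zero => simp [zonalLead]
  | succ k ih =>
    refine ⟨ih.2, ?_⟩
    have := k.cast_nonneg (α := ℝ)
    rw [zonalLead]
    exact mul_pos (inv_pos.mpr (by linarith)) (mul_pos (by linarith) ih.2)

/-- Pairing with a harmonic polynomial sees only the leading power, since the remainder is a
multiple of the squared norm. -/
theorem zonal_eq_linearForm_pow_add (x : ι → ℝ) (k : ℕ) :
    (∃ R, zonal x k = C (zonalLead (Fintype.card ι) k) * linearForm x ^ k + normSqPoly ι * R)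
      ∧ ∃ R, zonal x (k + 1) = C (zonalLead (Fintype.card ι) (k + 1)) * linearForm x ^ (k + 1)
        + normSqPoly ι * R := by
  induction k with
  | zero => exact ⟨⟨0, by simp [zonal, zonalLead]⟩, ⟨0, by simp [zonal, zonalLead]⟩⟩
  | succ k ih =>
    refine ⟨ih.2, ?_⟩
    obtain ⟨R, hR⟩ := ih.2
    refine ⟨C ((k + Fintype.card ι - 1 : ℝ)⁻¹) *
        (C (2 * k + Fintype.card ι : ℝ) * (linearForm x * R)
          - C ((k + 1) * ∑ i, x i * x i) * zonal x k), ?_⟩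
    rw [zonal, zonalLead, hR]
    simp only [C_mul]
    ring

/-- Positive definiteness of the Gegenbauer kernel in dimension at least two. -/
theorem sum_homGegenbauer_nonneg_of_two_le {α : Type*} (s : Finset α) (f : α → ℝ)
    (x : α → ι → ℝ) (hm : 2 ≤ Fintype.card ι) (k : ℕ) :
    0 ≤ ∑ a ∈ s, ∑ b ∈ s, f a * f b * homGegenbauer (Fintype.card ι) k
      (∑ i, x a i * x b i) ((∑ i, x a i * x a i) * ∑ i, x b i * x b i) := by
  have hlead := (zonalLead_pos (m := Fintype.card ι) (by exact_mod_cast hm) k).1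
  choose R hR using fun a => (zonal_eq_linearForm_pow_add (x a) k).1
  set P := ∑ a ∈ s, f a • zonal (x a) k with hP
  have hlap : laplacePoly P = 0 := by
    simp only [laplacePoly, hP, map_sum, Derivation.map_smul]
    rw [Finset.sum_comm]
    simp only [← Finset.smul_sum]
    exact Finset.sum_eq_zero fun a _ => by
      rw [show ∑ i, pderiv i (pderiv i (zonal (x a) k)) = 0 from (laplacePoly_zonal (x a) hm k).1,
        smul_zero]
  have hhom : P.IsHomogeneous k := IsHomogeneous.sum _ _ _ fun a _ => by
    rw [smul_eq_C_mul]
    simpa using (isHomogeneous_C ι (f a)).mul (zonal_isHomogeneous (x a) k).1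
  -- In the left slot each zonal polynomial may be replaced by its leading power, because `P` is
  -- harmonic; that power then evaluates `P` at the pole.
  have hkey : fischer ι P P = zonalLead (Fintype.card ι) k * k.factorial *
      ∑ a ∈ s, f a * eval (x a) P := by
    have hlin : ∀ q, fischer ι P q = ∑ a ∈ s, f a * fischer ι (zonal (x a) k) q := fun q => by
      simp [hP, LinearMap.sum_apply]
    rw [hlin, Finset.mul_sum]
    refine Finset.sum_congr rfl fun a _ => ?_
    rw [hR a, map_add, LinearMap.add_apply, fischer_normSqPoly_mul, hlap, map_zero, add_zero, ← smul_eq_C_mul, map_smul,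
      LinearMap.smul_apply, fischer_linearForm_pow (x a) hhom]
    simp only [smul_eq_mul]
    ring
  have hsum : ∑ a ∈ s, f a * eval (x a) P = ∑ a ∈ s, ∑ b ∈ s, f a * f b *
      homGegenbauer (Fintype.card ι) k
        (∑ i, x a i * x b i) ((∑ i, x a i * x a i) * ∑ i, x b i * x b i) := by
    simp only [hP, map_sum]
    simp_rw [Finset.mul_sum s]
    rw [Finset.sum_comm]
    refine Finset.sum_congr rfl fun a _ => Finset.sum_congr rfl fun b _ => ?_
    rw [smul_eval, (eval_zonal (x a) (x b) k).1]
    ring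
  rw [← hsum]
  have hnn := fischer_self_nonneg P
  rw [hkey] at hnn
  exact nonneg_of_mul_nonneg_right hnn (by positivity)

/-- Positive definiteness of the Gegenbauer kernel; in degree at most one every dimension is
allowed. -/
theorem sum_homGegenbauer_nonneg {α : Type*} (s : Finset α) (f : α → ℝ)
    (x : α → ι → ℝ) (k : ℕ) (hm : 2 ≤ Fintype.card ι ∨ k ≤ 1) :
    0 ≤ ∑ a ∈ s, ∑ b ∈ s, f a * f b * homGegenbauer (Fintype.card ι) k
      (∑ i, x a i * x b i) ((∑ i, x a i * x a i) * ∑ i, x b i * x b i) := by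
  rcases hm with hm | hk
  · exact sum_homGegenbauer_nonneg_of_two_le s f x hm k
  interval_cases k
  · simp only [homGegenbauer, mul_one, ← Finset.sum_mul_sum]
    exact mul_self_nonneg _
  · simp only [homGegenbauer]
    have h : ∑ a ∈ s, ∑ b ∈ s, f a * f b * ∑ i, x a i * x b i
        = ∑ i, (∑ a ∈ s, f a * x a i) * ∑ b ∈ s, f b * x b i := by
      simp_rw [Finset.sum_mul_sum, Finset.mul_sum]
      rw [Finset.sum_comm]
      conv_rhs => rw [Finset.sum_comm]
      refine Finset.sum_congr rfl fun a _ => ?_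
      conv_rhs => rw [Finset.sum_comm]
      exact Finset.sum_congr rfl fun b _ => Finset.sum_congr rfl fun i _ => by ring
    rw [h]
    exact Finset.sum_nonneg fun i _ => mul_self_nonneg _

end Zonal

/-! ### Ordered triples, their inner products and symmetrization. -/

section Triples

/-- The index triple of `pattern`, where `0` stands for `1` and `i` for `d_i`. -/
def patternIndex : Fin 13 → Fin 3 → Fin 4 :=
  ![![1, 1, 0], ![2, 2, 0], ![3, 3, 0], ![1, 1, 1], ![2, 2, 2], ![3, 3, 3],
    ![1, 1, 2], ![1, 1, 3], ![2, 2, 1], ![2, 2, 3], ![3, 3, 1], ![3, 3, 2], ![1, 2, 3]]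

theorem pattern_eq_comp (d₁ d₂ d₃ : ℝ) (j : Fin 13) :
    pattern d₁ d₂ d₃ j = ![1, d₁, d₂, d₃] ∘ patternIndex j := by
  fin_cases j <;> (ext i; fin_cases i <;> rfl)

/-- The second hypothesis is the geometric restriction: inner product `1` means that two points
coincide, so their inner products with the third agree. A finite check shows that the patterns
exhaust the remaining cases. -/
theorem exists_comp_eq_patternIndex : ∀ w : Fin 3 → Fin 4, w ≠ (fun _ => 0) →
    (∀ i, w i = 0 → w (i + 1) = w (i + 2)) →
    ∃ j, ∃ σ : Equiv.Perm (Fin 3), w ∘ σ = patternIndex j := by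
  decide +kernel

theorem patternIndex_comp_eq : ∀ j j' : Fin 13, ∀ σ : Equiv.Perm (Fin 3),
    patternIndex j ∘ σ = patternIndex j' → j = j' := by
  decide +kernel

theorem patternIndex_ne_zero : ∀ j : Fin 13, patternIndex j ≠ fun _ => 0 := by
  decide

theorem perm_add_one_add_two : ∀ (σ : Equiv.Perm (Fin 3)) (i : Fin 3),
    (σ (i + 1) = σ i + 1 ∧ σ (i + 2) = σ i + 2) ∨
      (σ (i + 1) = σ i + 2 ∧ σ (i + 2) = σ i + 1) := by
  decide

variable {E : Type*} [NormedAddCommGroup E] [InnerProductSpace ℝ E]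

/-- The inner products of a triple of points; entry `i` belongs to the pair omitting `v i`. -/
noncomputable def tripleInner (v : Fin 3 → E) : Fin 3 → ℝ := fun i =>
  inner ℝ (v (i + 1)) (v (i + 2))

/-- Labelling each pair by the omitted index makes the inner products equivariant: a permutation of
`Fin 3` either preserves or reverses the cyclic order, and symmetry of the inner product absorbs the
reversal. -/
theorem tripleInner_comp (v : Fin 3 → E) (σ : Equiv.Perm (Fin 3)) :
    tripleInner (v ∘ σ) = tripleInner v ∘ σ := by
  ext i
  simp only [tripleInner, Function.comp_apply]
  rcases perm_add_one_add_two σ i with ⟨h1, h2⟩ | ⟨h1, h2⟩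
  · rw [h1, h2]
  · rw [h1, h2, real_inner_comm]

theorem sum_tripleInner_comp {M : Type*} [AddCommMonoid M] (X : Finset E)
    (f : (Fin 3 → ℝ) → M) (σ : Equiv.Perm (Fin 3)) :
    ∑ v ∈ Fintype.piFinset (fun _ : Fin 3 => X), f (tripleInner v ∘ σ)
      = ∑ v ∈ Fintype.piFinset (fun _ : Fin 3 => X), f (tripleInner v) := by
  refine Finset.sum_nbij' (fun v => v ∘ σ) (fun v => v ∘ σ.symm) ?_ ?_ ?_ ?_ ?_
  · intro v hv
    simp only [Fintype.mem_piFinset] at hv ⊢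
    exact fun i => hv _
  · intro v hv
    simp only [Fintype.mem_piFinset] at hv ⊢
    exact fun i => hv _
  · intro v _
    ext i; simp
  · intro v _
    ext i; simp
  · intro v _
    rw [tripleInner_comp]

theorem sum_piFinset_three {A M : Type*} [AddCommMonoid M] (X : Finset A)
    (g : (Fin 3 → A) → M) :
    ∑ v ∈ Fintype.piFinset (fun _ : Fin 3 => X), g v
      = ∑ z ∈ X, ∑ x ∈ X, ∑ y ∈ X, g ![x, y, z] := by
  simp_rw [← Finset.sum_product']
  refine Finset.sum_nbij' (fun v => (v 2, v 0, v 1)) (fun q => ![q.2.1, q.2.2, q.1])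
    ?_ ?_ ?_ ?_ ?_
  · intro v hv
    simp only [Fintype.mem_piFinset] at hv
    simp [hv]
  · rintro ⟨z, x, y⟩ hq
    simp only [Finset.mem_product] at hq
    simp [Fintype.mem_piFinset, Fin.forall_fin_succ, hq]
  · intro v _
    ext i; fin_cases i <;> rfl
  · intro q _
    rfl
  · intro v _
    congr 1
    ext i; fin_cases i <;> rfl

theorem tripleInner_vec (x y z : E) :
    tripleInner ![x, y, z] = ![inner ℝ y z, inner ℝ z x, inner ℝ x y] := by
  ext i; fin_cases i <;> rfl

/-- The average of `f` over the permutations of its three arguments. -/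
noncomputable def symmetrize {M : Type*} [AddCommGroup M] [Module ℝ M] (f : (Fin 3 → ℝ) → M)
    (w : Fin 3 → ℝ) : M :=
  (1 / 6 : ℝ) • ∑ σ : Equiv.Perm (Fin 3), f (w ∘ σ)

theorem symmetrize_comp {M : Type*} [AddCommGroup M] [Module ℝ M] (f : (Fin 3 → ℝ) → M)
    (w : Fin 3 → ℝ) (τ : Equiv.Perm (Fin 3)) : symmetrize f (w ∘ τ) = symmetrize f w := by
  rw [symmetrize, symmetrize]
  congr 1
  exact Fintype.sum_equiv (Equiv.mulLeft τ) _ _ fun σ => rfl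

theorem sum_symmetrize_tripleInner {M : Type*} [AddCommGroup M] [Module ℝ M] (X : Finset E)
    (f : (Fin 3 → ℝ) → M) :
    ∑ v ∈ Fintype.piFinset (fun _ : Fin 3 => X), symmetrize f (tripleInner v)
      = ∑ v ∈ Fintype.piFinset (fun _ : Fin 3 => X), f (tripleInner v) := by
  simp only [symmetrize]
  rw [← Finset.smul_sum, Finset.sum_comm]
  simp only [sum_tripleInner_comp, Finset.sum_const, Finset.card_univ, Fintype.card_perm,
    Fintype.card_fin]
  rw [← Nat.cast_smul_eq_nsmul ℝ, smul_smul]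
  norm_num [Nat.factorial]

end Triples

/-! ### Sorting the triples of a three-distance set by pattern. -/

section Counting

variable {n : ℕ} {X : Finset (EuclideanSpace ℝ (Fin n))} {d₁ d₂ d₃ : ℝ}

theorem IsThreeDistanceSet.inner_eq_one_iff (hX : IsThreeDistanceSet X d₁ d₂ d₃)
    {x y : EuclideanSpace ℝ (Fin n)} (hx : x ∈ X) (hy : y ∈ X) : inner ℝ x y = 1 ↔ x = y :=
  inner_eq_one_iff_of_norm_eq_one (hX.norm_eq_one x hx) (hX.norm_eq_one y hy)

theorem IsThreeDistanceSet.values_injective (hX : IsThreeDistanceSet X d₁ d₂ d₃) :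
    Function.Injective ![1, d₁, d₂, d₃] := by
  have h : ∀ d ∈ ({d₁, d₂, d₃} : Set ℝ), d ≠ 1 := by
    intro d hd
    rw [← hX.inner_eq] at hd
    obtain ⟨x, hx, y, hy, hne, rfl⟩ := hd
    exact fun h => hne ((hX.inner_eq_one_iff hx hy).mp h)
  have h1 := h d₁ (by simp)
  have h2 := h d₂ (by simp)
  have h3 := h d₃ (by simp)
  have := hX.ne₁₂
  have := hX.ne₁₃
  have := hX.ne₂₃
  intro i j hij
  fin_cases i <;> fin_cases j <;> simp_all [eq_comm]

theorem IsThreeDistanceSet.exists_index (hX : IsThreeDistanceSet X d₁ d₂ d₃)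
    {v : Fin 3 → EuclideanSpace ℝ (Fin n)} (hv : ∀ i, v i ∈ X) :
    ∃ w : Fin 3 → Fin 4, tripleInner v = ![1, d₁, d₂, d₃] ∘ w
      ∧ ∀ i, w i = 0 → w (i + 1) = w (i + 2) := by
  have h : ∀ i, ∃ a : Fin 4, tripleInner v i = ![1, d₁, d₂, d₃] a := by
    intro i
    by_cases he : v (i + 1) = v (i + 2)
    · exact ⟨0, (hX.inner_eq_one_iff (hv _) (hv _)).mpr he⟩
    · have hm : tripleInner v i ∈ ({d₁, d₂, d₃} : Set ℝ) := by
        rw [← hX.inner_eq]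
        exact ⟨_, hv _, _, hv _, he, rfl⟩
      rcases hm with hm | hm | hm
      · exact ⟨1, hm⟩
      · exact ⟨2, hm⟩
      · exact ⟨3, hm⟩
  choose w hw using h
  refine ⟨w, funext hw, fun i hi => hX.values_injective ?_⟩
  have he : v (i + 1) = v (i + 2) := by
    rw [← hX.inner_eq_one_iff (hv _) (hv _)]
    exact (hw i).trans (by simp [hi])
  rw [← hw, ← hw, tripleInner, tripleInner]
  have h1 : i + 1 + 1 = i + 2 := by fin_cases i <;> rfl
  have h2 : i + 1 + 2 = i := by fin_cases i <;> rfl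
  have h3 : i + 2 + 1 = i := by fin_cases i <;> rfl
  have h4 : i + 2 + 2 = i + 1 := by fin_cases i <;> rfl
  rw [h1, h2, h3, h4, he, real_inner_comm]

theorem IsThreeDistanceSet.card_pos (hX : IsThreeDistanceSet X d₁ d₂ d₃) : 0 < X.card := by
  have h : d₁ ∈ ({d₁, d₂, d₃} : Set ℝ) := by simp
  rw [← hX.inner_eq] at h
  obtain ⟨x, hx, -⟩ := h
  exact Finset.card_pos.mpr ⟨x, hx⟩

open Classical in
theorem card_mul_tripleCount (hc : 0 < X.card) (j : Fin 13) :
    (X.card : ℝ) * tripleCount X d₁ d₂ d₃ j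
      = (((Fintype.piFinset (fun _ : Fin 3 => X)).filter fun v =>
        ∃ σ : Equiv.Perm (Fin 3), tripleInner v ∘ σ = pattern d₁ d₂ d₃ j).card : ℝ) := by
  have hc' : (X.card : ℝ) ≠ 0 := by exact_mod_cast hc.ne'
  rw [tripleCount, mul_div_cancel₀ _ hc', ← Set.ncard_coe_finset]
  congr 1
  symm
  refine Set.ncard_congr (fun v _ => (v 0, v 1, v 2)) ?_ ?_ ?_
  · intro v hv
    simp only [Finset.coe_filter, Fintype.mem_piFinset, Set.mem_ofPred_eq] at hv ⊢
    obtain ⟨hm, σ, hσ⟩ := hv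
    -- `tripleCount` lists the products as `xy, xz, yz`, whereas `tripleInner` lists them as `yz,
    -- zx, xy`; the swap reverses the order.
    refine ⟨hm 0, hm 1, hm 2, σ.trans (Equiv.swap 0 2), ?_⟩
    rw [← hσ]
    ext i
    simp only [Function.comp_apply, Equiv.coe_trans]
    generalize σ i = a
    fin_cases a
    · rfl
    · exact real_inner_comm _ _
    · rfl
  · intro v v' _ _ h
    simp only [Prod.mk.injEq] at h
    ext i : 1
    fin_cases i
    exacts [h.1, h.2.1, h.2.2]
  · rintro ⟨x, y, z⟩ ⟨hx, hy, hz, σ, hσ⟩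
    refine ⟨![x, y, z], ?_, rfl⟩
    simp only [Finset.coe_filter, Fintype.mem_piFinset, Set.mem_ofPred_eq]
    refine ⟨by simp [Fin.forall_fin_succ, hx, hy, hz], σ.trans (Equiv.swap 0 2), ?_⟩
    rw [← hσ]
    ext i
    simp only [Function.comp_apply, Equiv.coe_trans]
    generalize σ i = a
    fin_cases a
    · rfl
    · exact real_inner_comm _ _
    · rfl

open Classical in
theorem IsThreeDistanceSet.card_filter_tripleInner_eq_one
    (hX : IsThreeDistanceSet X d₁ d₂ d₃) :
    ((Fintype.piFinset (fun _ : Fin 3 => X)).filter fun v =>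
      tripleInner v = fun _ => 1).card = X.card := by
  symm
  refine Finset.card_bij (fun x _ => fun _ => x) ?_ ?_ ?_
  · intro x hx
    simp only [Finset.mem_filter, Fintype.mem_piFinset]
    exact ⟨fun _ => hx, funext fun i => (hX.inner_eq_one_iff hx hx).mpr rfl⟩
  · intro x _ y _ h
    exact congrFun h 0
  · intro v hv
    simp only [Finset.mem_filter, Fintype.mem_piFinset] at hv
    have h : ∀ i, v (i + 1) = v (i + 2) := fun i =>
      (hX.inner_eq_one_iff (hv.1 _) (hv.1 _)).mp (congrFun hv.2 i)
    refine ⟨v 0, hv.1 0, ?_⟩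
    have h1 : v 2 = v 0 := h 1
    have h2 : v 0 = v 1 := h 2
    ext i : 1
    fin_cases i
    exacts [rfl, h2, h1.symm]

open Classical in
-- Exactly one summand on the right is active: the inner products are all `1`, or they match one and
-- only one pattern up to order.
theorem IsThreeDistanceSet.apply_tripleInner (hX : IsThreeDistanceSet X d₁ d₂ d₃)
    {M : Type*} [AddCommGroup M] {F : (Fin 3 → ℝ) → M}
    (hF : ∀ w (σ : Equiv.Perm (Fin 3)), F (w ∘ σ) = F w)
    {v : Fin 3 → EuclideanSpace ℝ (Fin n)} (hv : ∀ i, v i ∈ X) :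
    F (tripleInner v) = (if tripleInner v = fun _ => 1 then F ![1, 1, 1] else 0)
      + ∑ j, if ∃ σ : Equiv.Perm (Fin 3), tripleInner v ∘ σ = pattern d₁ d₂ d₃ j
          then F (pattern d₁ d₂ d₃ j) else 0 := by
  obtain ⟨w, hw, hw0⟩ := hX.exists_index hv
  have hinj := hX.values_injective
  have hone : (fun _ => 1 : Fin 3 → ℝ) = ![1, d₁, d₂, d₃] ∘ fun _ => 0 := by
    ext i; simp
  have hmatch : ∀ j, (∃ σ : Equiv.Perm (Fin 3), tripleInner v ∘ σ = pattern d₁ d₂ d₃ j)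
      ↔ ∃ σ : Equiv.Perm (Fin 3), w ∘ σ = patternIndex j := by
    intro j
    refine exists_congr fun σ => ?_
    rw [hw, pattern_eq_comp, Function.comp_assoc]
    exact hinj.comp_left.eq_iff
  have hconst : tripleInner v = (fun _ => 1) ↔ w = fun _ => 0 := by
    rw [hw, hone]
    exact hinj.comp_left.eq_iff
  simp only [hmatch, hconst]
  by_cases h0 : w = fun _ => 0
  · have hno : ∀ j, ¬ ∃ σ : Equiv.Perm (Fin 3), w ∘ σ = patternIndex j := by
      rintro j ⟨σ, hσ⟩
      exact patternIndex_ne_zero j (by rw [← hσ, h0]; rfl)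
    have h1 : (![1, 1, 1] : Fin 3 → ℝ) = fun _ => 1 := by
      ext i; fin_cases i <;> rfl
    simp only [hno, if_false, Finset.sum_const_zero, add_zero, if_pos h0]
    rw [hconst.mpr h0, h1]
  · obtain ⟨j, σ, hσ⟩ := exists_comp_eq_patternIndex w h0 hw0
    rw [if_neg h0, zero_add, Finset.sum_eq_single j, if_pos ⟨σ, hσ⟩, pattern_eq_comp, ← hσ,
      ← Function.comp_assoc, ← hw, hF]
    · rintro j' - hj'
      refine if_neg ?_
      rintro ⟨τ, hτ⟩
      refine hj' (patternIndex_comp_eq j' j (τ⁻¹ * σ) ?_)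
      rw [← hτ, ← hσ]
      ext i : 1
      simp
    · simp

/-- Summation of a symmetric function over the triples of a three-distance set, sorted by the
inner products of the triples. -/
theorem IsThreeDistanceSet.sum_tripleInner (hX : IsThreeDistanceSet X d₁ d₂ d₃)
    {M : Type*} [AddCommGroup M] [Module ℝ M] (f : (Fin 3 → ℝ) → M) :
    (X.card : ℝ) • (symmetrize f ![1, 1, 1]
        + ∑ j, tripleCount X d₁ d₂ d₃ j • symmetrize f (pattern d₁ d₂ d₃ j))
      = ∑ z ∈ X, ∑ x ∈ X, ∑ y ∈ X, f ![inner ℝ y z, inner ℝ z x, inner ℝ x y] := by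
  classical
  have h1 := sum_piFinset_three X fun v => f (tripleInner v)
  simp only [tripleInner_vec] at h1
  rw [← h1, ← sum_symmetrize_tripleInner, Finset.sum_congr rfl fun v hv =>
    hX.apply_tripleInner (symmetrize_comp f) (Fintype.mem_piFinset.mp hv),
    Finset.sum_add_distrib, Finset.sum_comm, ← Finset.sum_filter, Finset.sum_const,
    hX.card_filter_tripleInner_eq_one, smul_add, Nat.cast_smul_eq_nsmul, Finset.smul_sum]
  congr 1
  refine Finset.sum_congr rfl fun j _ => ?_
  rw [← Finset.sum_filter, Finset.sum_const, smul_smul, card_mul_tripleCount hX.card_pos,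
    Nat.cast_smul_eq_nsmul]

end Counting

/-! ### Verification of the constraints and the objective. -/

section Feasibility

variable {n : ℕ} {X : Finset (EuclideanSpace ℝ (Fin n))} {d₁ d₂ d₃ : ℝ}

/-- Dimension zero has no unit vectors, and in dimension one distinct unit vectors have inner
product `-1`, leaving no room for different values. -/
theorem IsThreeDistanceSet.two_le (hX : IsThreeDistanceSet X d₁ d₂ d₃) : 2 ≤ n := by
  by_contra! hn
  have h : ∀ d ∈ ({d₁, d₂, d₃} : Set ℝ), d = -1 := by
    intro d hd
    rw [← hX.inner_eq] at hd
    obtain ⟨x, hx, y, hy, hne, rfl⟩ := hd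
    have hx1 := hX.norm_eq_one x hx
    have hy1 := hX.norm_eq_one y hy
    have hin : inner ℝ x y ≠ 1 := fun h => hne ((hX.inner_eq_one_iff hx hy).mp h)
    interval_cases n
    · simp [Subsingleton.elim x 0] at hx1
    · rw [EuclideanSpace.norm_eq, Real.sqrt_eq_one] at hx1 hy1
      simp only [Finset.univ_unique, Finset.sum_singleton, Real.norm_eq_abs, sq_abs,
        PiLp.inner_apply, RCLike.inner_apply, conj_trivial] at hx1 hy1 hin ⊢
      rcases sq_eq_one_iff.mp hx1 with h1 | h1 <;>
        rcases sq_eq_one_iff.mp hy1 with h2 | h2 <;> simp_all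
  exact hX.ne₁₂ ((h d₁ (by simp)).trans (h d₂ (by simp)).symm)

theorem sum_perm_three {M : Type*} [AddCommMonoid M] (f : (Fin 3 → ℝ) → M) (a b c : ℝ) :
    ∑ σ : Equiv.Perm (Fin 3), f (![a, b, c] ∘ σ)
      = f ![a, b, c] + f ![b, a, c] + f ![c, b, a] + f ![a, c, b] + f ![b, c, a]
        + f ![c, a, b] := by
  have hu : (Finset.univ : Finset (Equiv.Perm (Fin 3)))
      = {1, Equiv.swap 0 1, Equiv.swap 0 2, Equiv.swap 1 2,
        Equiv.swap 0 1 * Equiv.swap 1 2, Equiv.swap 1 2 * Equiv.swap 0 1} := by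
    decide
  rw [hu, Finset.sum_insert (by decide), Finset.sum_insert (by decide),
    Finset.sum_insert (by decide), Finset.sum_insert (by decide), Finset.sum_insert (by decide),
    Finset.sum_singleton]
  simp only [← add_assoc]
  congr 1 <;> [congr 1 <;> [congr 1 <;> [congr 1 <;> [congr 1; skip]; skip]; skip]; skip]
  all_goals
    congr 1
    ext i
    fin_cases i <;> rfl

/-- Counts all `|X|³` triples by summing the constant function `1`. -/
theorem IsThreeDistanceSet.one_add_sum_tripleCount (hX : IsThreeDistanceSet X d₁ d₂ d₃) :
    1 + ∑ j, tripleCount X d₁ d₂ d₃ j = (X.card : ℝ) ^ 2 := by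
  have h := hX.sum_tripleInner (fun _ => (1 : ℝ))
  have hs : ∀ w, symmetrize (fun _ => (1 : ℝ)) w = 1 := fun w => by
    simp [symmetrize, Fintype.card_perm, Nat.factorial]
  have hc : (X.card : ℝ) ≠ 0 := by exact_mod_cast hX.card_pos.ne'
  simp only [hs, smul_eq_mul, mul_one, Finset.sum_const, nsmul_eq_mul] at h
  apply mul_left_cancel₀ hc
  rw [h]
  ring

/-- Sorting the pairs of points by their inner products. -/
theorem IsThreeDistanceSet.sum_pairs (hX : IsThreeDistanceSet X d₁ d₂ d₃) (g : ℝ → ℝ) :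
    (X.card : ℝ) * (3 * g 1 + tripleCount X d₁ d₂ d₃ 0 * g d₁ + tripleCount X d₁ d₂ d₃ 1 * g d₂
        + tripleCount X d₁ d₂ d₃ 2 * g d₃)
      = 3 * ∑ x ∈ X, ∑ y ∈ X, g (inner ℝ x y) := by
  classical
  -- The condition `⟨y, z⟩ = 1` forces `y = z`, so the triple sum of `f` collapses to a pair sum.
  -- Symmetrizing gives `g d / 3` at `(d, d, 1)`, whence the factor `3`.
  obtain ⟨f, hf⟩ : ∃ f : (Fin 3 → ℝ) → ℝ, ∀ a b c, f ![a, b, c] = if a = 1 then g b else 0 :=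
    ⟨fun w => if w 0 = 1 then g (w 1) else 0, fun _ _ _ => rfl⟩
  have h := hX.sum_tripleInner f
  have h1 : d₁ ≠ 1 := fun h => by simpa using hX.values_injective (a₁ := 1) (a₂ := 0) h
  have h2 : d₂ ≠ 1 := fun h => by simpa using hX.values_injective (a₁ := 2) (a₂ := 0) h
  have h3 : d₃ ≠ 1 := fun h => by simpa using hX.values_injective (a₁ := 3) (a₂ := 0) h
  have hr : ∀ z ∈ X, ∀ x ∈ X,
      ∑ y ∈ X, f ![inner ℝ y z, inner ℝ z x, inner ℝ x y] = g (inner ℝ z x) := fun z hz x _ => by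
    simp only [hf]
    rw [Finset.sum_congr rfl fun y hy => if_congr (hX.inner_eq_one_iff hy hz) rfl rfl,
      Finset.sum_ite_eq' X z, if_pos hz]
  rw [Finset.sum_congr rfl fun z hz => Finset.sum_congr rfl (hr z hz)] at h
  have hs : ∀ a b c, symmetrize f ![a, b, c] = 1 / 6 * ((if a = 1 then g b + g c else 0)
      + (if b = 1 then g a + g c else 0) + if c = 1 then g a + g b else 0) := fun a b c => by
    rw [symmetrize, sum_perm_three]
    simp only [hf, smul_eq_mul]
    split_ifs <;> ring
  rw [← h]
  simp [Fin.sum_univ_succ, pattern, hs, h1, h2, h3]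
  ring

theorem IsThreeDistanceSet.sum_tripleCount_pairs (hX : IsThreeDistanceSet X d₁ d₂ d₃) :
    tripleCount X d₁ d₂ d₃ 0 + tripleCount X d₁ d₂ d₃ 1 + tripleCount X d₁ d₂ d₃ 2
      = 3 * (X.card : ℝ) - 3 := by
  have h := hX.sum_pairs fun _ => 1
  have hc : (X.card : ℝ) ≠ 0 := by exact_mod_cast hX.card_pos.ne'
  simp only [mul_one, Finset.sum_const, nsmul_eq_mul] at h
  apply mul_left_cancel₀ hc
  linear_combination h

theorem gegenbauer_eq_homGegenbauer (m : ℝ) (k : ℕ) (t : ℝ) :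
    gegenbauer m k t = homGegenbauer m k t 1 := by
  rw [(homGegenbauer_eq_sqrt m t 1 one_pos k).1]
  simp

theorem gegenbauer_one {m : ℝ} (hm : 2 ≤ m) (k : ℕ) :
    gegenbauer m k 1 = 1 ∧ gegenbauer m (k + 1) 1 = 1 := by
  induction k with
  | zero => simp [gegenbauer]
  | succ k ih =>
    refine ⟨ih.2, ?_⟩
    rw [gegenbauer, ih.1, ih.2, div_eq_one_iff_eq]
    · ring
    · have := k.cast_nonneg (α := ℝ)
      linarith

theorem IsThreeDistanceSet.delsarte_tripleCount (hX : IsThreeDistanceSet X d₁ d₂ d₃) (k : ℕ) :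
    0 ≤ 3 + tripleCount X d₁ d₂ d₃ 0 * gegenbauer n k d₁
      + tripleCount X d₁ d₂ d₃ 1 * gegenbauer n k d₂
      + tripleCount X d₁ d₂ d₃ 2 * gegenbauer n k d₃ := by
  have h := hX.sum_pairs (gegenbauer n k)
  rw [(gegenbauer_one (by exact_mod_cast hX.two_le) k).1, mul_one] at h
  have hc : (0 : ℝ) < X.card := by exact_mod_cast hX.card_pos
  refine nonneg_of_mul_nonneg_right (h ▸ mul_nonneg (by norm_num) ?_) hc
  have hpos := sum_homGegenbauer_nonneg X (fun _ => 1) (fun x i => x i) k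
    (Or.inl (by simpa using hX.two_le))
  refine hpos.trans_eq (Finset.sum_congr rfl fun x hx => Finset.sum_congr rfl fun y hy => ?_)
  have hin : ∀ u v : EuclideanSpace ℝ (Fin n), ∑ i, u i * v i = inner ℝ u v := fun u v => by
    simp [PiLp.inner_apply, mul_comm]
  rw [hin, hin, hin, (hX.inner_eq_one_iff hx hx).mpr rfl, (hX.inner_eq_one_iff hy hy).mpr rfl,
    gegenbauer_eq_homGegenbauer]
  simp

/-- Coordinates on the orthogonal complement of a unit vector. -/
theorem exists_coords_orthogonal {m : ℕ} (z : EuclideanSpace ℝ (Fin (m + 1))) (hz : ‖z‖ = 1) :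
    ∃ c : EuclideanSpace ℝ (Fin (m + 1)) → Fin m → ℝ, ∀ x y,
      ∑ i, c x i * c y i = inner ℝ x y - inner ℝ x z * inner ℝ y z := by
  have : Fact (Module.finrank ℝ (EuclideanSpace ℝ (Fin (m + 1))) = m + 1) := ⟨by simp⟩
  have hz0 : z ≠ 0 := by rintro rfl; simp at hz
  let b := OrthonormalBasis.fromOrthogonalSpanSingleton (𝕜 := ℝ) m hz0
  have hzz : inner ℝ z z = (1 : ℝ) := by rw [real_inner_self_eq_norm_sq, hz, one_pow]
  have hmem : ∀ x : EuclideanSpace ℝ (Fin (m + 1)),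
      x - (inner ℝ x z : ℝ) • z ∈ (Submodule.span ℝ {z})ᗮ := fun x => by
    rw [Submodule.mem_orthogonal_singleton_iff_inner_right, inner_sub_right, inner_smul_right,
      hzz, real_inner_comm]
    ring
  refine ⟨fun x i => inner ℝ (⟨_, hmem x⟩ : (Submodule.span ℝ {z})ᗮ) (b i), fun x y => ?_⟩
  have h := b.sum_inner_mul_inner ⟨_, hmem x⟩ ⟨_, hmem y⟩
  simp_rw [real_inner_comm (b _) (⟨_, hmem y⟩ : (Submodule.span ℝ {z})ᗮ)]
  rw [h, Submodule.coe_inner, inner_sub_left, inner_sub_right, inner_sub_right, inner_smul_left,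
    inner_smul_right, inner_smul_left, inner_smul_right, hzz, real_inner_comm y z]
  simp
  ring

theorem matS_eq_symmetrize (n p k : ℕ) : matS n p k = symmetrize (matY n p k) := rfl

theorem matY_transpose (n p k : ℕ) (u v t : ℝ) :
    (matY n p k ![u, v, t]).transpose = matY n p k ![v, u, t] := by
  ext i j
  simp only [matY, Matrix.transpose_apply, Matrix.of_apply, Matrix.cons_val]
  rw [mul_comm (u ^ _), mul_comm u v, mul_comm (1 - u ^ 2)]

/-- For a fixed unit vector `z` the matrices `Y_k` sum to a positive semidefinite matrix. -/
theorem sum_matY_posSemidef {m p k : ℕ} (hk : 2 ≤ m ∨ k ≤ 1)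
    (X : Finset (EuclideanSpace ℝ (Fin (m + 1)))) (hX : ∀ x ∈ X, ‖x‖ = 1)
    (z : EuclideanSpace ℝ (Fin (m + 1))) (hz : ‖z‖ = 1) :
    (∑ x ∈ X, ∑ y ∈ X,
      matY (m + 1) p k ![inner ℝ y z, inner ℝ z x, inner ℝ x y]).PosSemidef := by
  refine .of_dotProduct_mulVec_nonneg ?_ fun c => ?_
  · rw [Matrix.IsHermitian, Matrix.conjTranspose_eq_transpose_of_trivial]
    simp only [Matrix.transpose_sum, matY_transpose]
    rw [Finset.sum_comm]
    refine Finset.sum_congr rfl fun x _ => Finset.sum_congr rfl fun y _ => ?_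
    rw [real_inner_comm x z, real_inner_comm z y, real_inner_comm x y]
  · obtain ⟨b, hb⟩ := exists_coords_orthogonal z hz
    -- With these weights, expanding the kernel sum gives the quadratic form at `c`. The projections
    -- to the complement of `z` have inner products `⟨x, y⟩ - ⟨x, z⟩⟨y, z⟩` and squared norms `1 -
    -- ⟨x, z⟩²`, the arguments appearing in `matY`.
    have hpos := sum_homGegenbauer_nonneg X (fun x => ∑ i, c i * (inner ℝ x z) ^ (i : ℕ)) b k
      (by simpa using hk)
    refine hpos.trans_eq ?_
    have hone : ∀ x ∈ X, inner ℝ x x = (1 : ℝ) := fun x hx => by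
      rw [real_inner_self_eq_norm_sq, hX x hx, one_pow]
    rw [Finset.sum_comm]
    simp only [Matrix.sum_mulVec, dotProduct_sum]
    refine Finset.sum_congr rfl fun x hx => Finset.sum_congr rfl fun y hy => ?_
    rw [hb, hb, hb, hone x hx, hone y hy, Finset.sum_mul_sum, Finset.sum_mul]
    simp only [dotProduct, Matrix.mulVec, star_trivial, matY, Matrix.of_apply, Matrix.cons_val,
      Finset.mul_sum, Finset.sum_mul]
    refine Finset.sum_congr rfl fun i _ => Finset.sum_congr rfl fun j _ => ?_
    rw [real_inner_comm x z, real_inner_comm x y, Fintype.card_fin]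
    push_cast
    rw [add_sub_cancel_right, pow_two, pow_two]
    ring

theorem IsThreeDistanceSet.matS_posSemidef (hX : IsThreeDistanceSet X d₁ d₂ d₃) {p k : ℕ}
    (hk : 3 ≤ n ∨ k ≤ 1) :
    (matS n p k ![1, 1, 1]
      + ∑ j : Fin 13, tripleCount X d₁ d₂ d₃ j • matS n p k (pattern d₁ d₂ d₃ j)).PosSemidef := by
  obtain ⟨m, rfl⟩ : ∃ m, n = m + 1 := ⟨n - 1, by have := hX.two_le; omega⟩
  have hc : (0 : ℝ) < X.card := by exact_mod_cast hX.card_pos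
  have h := hX.sum_tripleInner (matY (m + 1) p k)
  rw [← eq_inv_smul_iff₀ hc.ne'] at h
  rw [matS_eq_symmetrize, h]
  refine Matrix.PosSemidef.smul ?_ (inv_nonneg.mpr hc.le)
  exact Matrix.posSemidef_sum _ fun z hz => sum_matY_posSemidef (by omega) X hX.norm_eq_one z
    (hX.norm_eq_one z hz)

theorem IsThreeDistanceSet.isFeasible_tripleCount (hX : IsThreeDistanceSet X d₁ d₂ d₃)
    (pLP pSDP : ℕ) (hn : 3 ≤ n ∨ pSDP ≤ 1) :
    IsFeasible n pLP pSDP d₁ d₂ d₃ (tripleCount X d₁ d₂ d₃) where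
  psd_two := by
    have h1 := hX.sum_tripleCount_pairs
    have h2 := hX.one_add_sum_tripleCount
    have h3 : ∑ j ∈ Finset.Ici (3 : Fin 13), tripleCount X d₁ d₂ d₃ j
        = (X.card : ℝ) ^ 2 - 3 * X.card + 2 := by
      have hu : (Finset.univ : Finset (Fin 13)) = {0, 1, 2} ∪ Finset.Ici 3 := by decide
      rw [hu, Finset.sum_union (by decide)] at h2
      rw [Finset.sum_insert (by decide), Finset.sum_insert (by decide),
        Finset.sum_singleton] at h2
      linarith
    rw [h1, h3]
    -- The lower right entry is `(|X| - 1) + (|X|² - 3|X| + 2) = (|X| - 1)²`, so the matrix is the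
    -- outer square of `(1, |X| - 1)`.
    have he : (!![1, 0; 0, 0] + ((1 / 3 : ℝ) * (3 * (X.card : ℝ) - 3)) • !![0, 1; 1, 1]
        + ((X.card : ℝ) ^ 2 - 3 * X.card + 2) • !![0, 0; 0, 1] : Matrix (Fin 2) (Fin 2) ℝ)
        = Matrix.vecMulVec ![1, (X.card : ℝ) - 1] (star ![1, (X.card : ℝ) - 1]) := by
      ext i j
      fin_cases i <;> fin_cases j <;> simp [Matrix.vecMulVec] <;> ring
    rw [he]
    exact Matrix.posSemidef_vecMulVec_self_star _
  delsarte k _ _ := hX.delsarte_tripleCount k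
  psd_S k hk := hX.matS_posSemidef (by omega)
  nonneg j := by unfold tripleCount; positivity

theorem IsThreeDistanceSet.objective_tripleCount (hX : IsThreeDistanceSet X d₁ d₂ d₃) :
    objective (tripleCount X d₁ d₂ d₃) = X.card := by
  rw [objective, hX.sum_tripleCount_pairs]
  ring

end Feasibility

end ThreeDistanceSDP

theorem mainTheorem4 (n pLP pSDP : ℕ) (hn : 3 ≤ n ∨ pSDP ≤ 1)
    (X : Finset (EuclideanSpace ℝ (Fin n))) (d₁ d₂ d₃ : ℝ)
    (hX : ThreeDistanceSDP.IsThreeDistanceSet X d₁ d₂ d₃) :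
    (((X.card : ℝ) : EReal) ≤ ThreeDistanceSDP.sdpOptimum n pLP pSDP d₁ d₂ d₃) ∧
    ThreeDistanceSDP.IsFeasible n pLP pSDP d₁ d₂ d₃
      (ThreeDistanceSDP.tripleCount X d₁ d₂ d₃) ∧
    ThreeDistanceSDP.objective (ThreeDistanceSDP.tripleCount X d₁ d₂ d₃) = (X.card : ℝ) := by
  have hf := hX.isFeasible_tripleCount pLP pSDP hn
  refine ⟨le_sSup ⟨_, hf, ?_⟩, hf, hX.objective_tripleCount⟩
  rw [hX.objective_tripleCount]
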